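/- Let $L\ge 3$ be an integer, regarded as the number of sites of the cycle $C_L$, with sites indexed modulo $L$. Notation. For a linear map $A:\mathbb{C}^D\otimes\mathbb{C}^D\to\mathbb{C}^d$, let $A^{\otimes L}|\Omega_D^{(C_L)}\rangle\in(\mathbb{C}^d)^{\otimes L}$ be the tensor obtained by applying $A$ at every site of $|\Omega_D^{(C_L)}\rangle$, the tensor product over the edges $\{i,i+1\}$ of $C_L$ of the unnormalised maximally entangled states $\sum_{j=1}^{D}|j\rangle\otimes|j\rangle$; the first factor of the $i$-th copy of $\mathbb{C}^D\otimes\mathbb{C}^D$ belongs to the edge $\{i-1,i\}$, the second to $\{i,i+1\}$. * $\mathrm{TNS}^{\mathrm{TI}\text{-}C_L}_{D,d}$ is the set of all tensors $A^{\otimes L}|\Omega_D^{(C_L)}\rangle$. The translation-invariant bond dimension $\mathrm{bond}^{\mathrm{TI}\text{-}C_L}(\psi)$ of $\psi\in(\mathbb{C}^d)^{\otimes L}$ is the least $D$ with $\psi\in\mathrm{TNS}^{\mathrm{TI}\text{-}C_L}_{D,d}$. * A border representation of $\psi$ of bond dimension $D$ and approximation degree $a\in\mathbb{N}_0$ is a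 linear map $A(\varepsilon):\mathbb{C}^D\otimes\mathbb{C}^D\to\mathbb{C}^d$, whose entries are polynomials in $\varepsilon$, such that $\psi=\lim_{\varepsilon\to0}\varepsilon^{-a}A(\varepsilon)^{\otimes L}|\Omega_D^{(C_L)}\rangle$. The translation-invariant border bond dimension $\underline{\mathrm{bond}}^{\mathrm{TI}\text{-}C_L}(\psi)$ is the least $D$ for which there is such a representation, of any approximation degree. * $\mathrm{bTNS}^{\mathrm{TI}\text{-}C_L}_{D,a,\mathfrak{d},d}$ is the set of all tensors $B^{\otimes L}\bigl(|\Omega_D^{(C_L)}\rangle\otimes|\chi_{a,\mathfrak{d},L}\rangle\bigr)$ with $B:(\mathbb{C}^D\otimes\mathbb{C}^D)\otimes\mathbb{C}^{\mathfrak{d}+1}\to\mathbb{C}^d$ linear, where $|\chi_{a,\mathfrak{d},L}\rangle=\sum_{i_1+\dots+i_L=a,\;0\le i_k\le\mathfrak{d}}|i_1,\dots,i_L\rangle$. For odd $L\ge 3$ let $$|\psi_L\rangle=\frac{1}{\sqrt L}\sum_{i=0}^{L-1}S^i|2\,1\,0\,1\,0\cdots1\,0\rangle\in(\mathbb{C}^3)^{\otimes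 L},$$ where $S$ is the cyclic shift of the tensor factors. Proposition. 1. For every odd $L\ge3$, $\underline{\mathrm{bond}}^{\mathrm{TI}\text{-}C_L}(\psi_L)=2$; there is a border representation of $\psi_L$ of bond dimension $2$ and approximation degree $1$ with entries of degree at most $1$ in $\varepsilon$; and $\psi_L\in\mathrm{bTNS}^{\mathrm{TI}\text{-}C_L}_{2,1,1,3}$. 2. As $L\to\infty$ through the odd integers, $\mathrm{bond}^{\mathrm{TI}\text{-}C_L}(\psi_L)=\Omega\!\left(\dfrac{L^{1/3}}{\log L}\right)$, that is, there are $c>0$ and $L_0$ such that $\mathrm{bond}^{\mathrm{TI}\text{-}C_L}(\psi_L)\ge c\,L^{1/3}/\log L$ for all odd $L\ge L_0$. 3. For every fixed $D$ there is $L_0$ such that $\psi_L\notin\mathrm{TNS}^{\mathrm{TI}\text{-}C_L}_{D,3}$ for all odd $L\ge L_0$. -/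

import Mathlib

open Filter Topology Polynomial

namespace TIMPS

/-- Tensors on `L` sites (labelled cyclically by `Fin L`), each carrying the vector space with
basis `ι`, given by their coordinates in the product basis: the space `(ℂ^ι)^{⊗ L}`. -/
abbrev State (ι : Type) (L : ℕ) : Type := (Fin L → ι) → ℂ

/-- The cyclic shift `S |i_1, i_2, …, i_L⟩ = |i_L, i_1, …, i_{L-1}⟩`; here `finRotate L` is
the successor map `i ↦ i + 1` modulo `L` on the sites. -/
noncomputable def shift (ι : Type) (L : ℕ) : State ι L →ₗ[ℂ] State ι L :=
  LinearMap.funLeft ℂ ℂ (fun x : Fin L → ι => x ∘ finRotate L)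

/-- `A^{⊗ L} φ`: the same local linear map `A : ℂ^ι → ℂ^κ` (given by its matrix)
applied at every site. -/
noncomputable def applyLocal {ι κ : Type} [Fintype ι] {L : ℕ} (A : Matrix κ ι ℂ)
    (φ : State ι L) : State κ L :=
  fun s => ∑ x : Fin L → ι, (∏ i, A (s i) (x i)) * φ x

/-- The site-wise tensor product of two tensors on the same sites. -/
def tensor {ι κ : Type} {L : ℕ} (φ : State ι L) (χ : State κ L) : State (ι × κ) L :=
  fun x => φ (fun i => (x i).1) * χ (fun i => (x i).2)

/-- The graph state `Ω_D` of the cycle `C_L`: an unnormalised maximally entangled pair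
`∑_j |j⟩ ⊗ |j⟩`, `j < D`, on every edge `{i, i + 1}`. Site `i` holds the half of the edge
`{i - 1, i}` as its first factor and the half of the edge `{i, i + 1}` as its second. -/
noncomputable def cycleState (D L : ℕ) : State (Fin D × Fin D) L :=
  fun x => ∏ i, if (x i).2 = (x (finRotate L i)).1 then 1 else 0

/-- The weight state of weight `a` on `L` sites of local dimension `δ + 1`: the sum of all
`|i_1, …, i_L⟩` with `0 ≤ i_k ≤ δ` and `i_1 + ⋯ + i_L = a`. -/
noncomputable def weightState (a δ L : ℕ) : State (Fin (δ + 1)) L :=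
  fun x => if ∑ i, (x i : ℕ) = a then 1 else 0

/-- `TNS^{TI-C_L}_{D,d}`: translation-invariant matrix product states on the cycle `C_L` with
bond dimension `D` and physical dimension `d`. -/
def TNS (L D d : ℕ) : Set (State (Fin d) L) :=
  {ψ | ∃ A : Matrix (Fin d) (Fin D × Fin D) ℂ, ψ = applyLocal A (cycleState D L)}

/-- `bTNS^{TI-C_L}_{D,a,δ,d}`: the ansatz class obtained by applying one and the same local
map at all sites of the cycle state tensored with the weight state. -/
def bTNS (L D a δ d : ℕ) : Set (State (Fin d) L) :=
  {ψ | ∃ B : Matrix (Fin d) ((Fin D × Fin D) × Fin (δ + 1)) ℂ,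
    ψ = applyLocal B (tensor (cycleState D L) (weightState a δ L))}

/-- The polynomial family of local maps `A(ε) : ℂ^D ⊗ ℂ^D → ℂ^d` represents `ψ` on the cycle
with approximation degree `a`: `ψ = lim_{ε → 0} ε^{-a} A(ε)^{⊗ L} Ω_D`. -/
def IsBorderRep {L D d : ℕ} (A : Matrix (Fin d) (Fin D × Fin D) ℂ[X]) (a : ℕ)
    (ψ : State (Fin d) L) : Prop :=
  Tendsto (fun ε : ℂ => (ε ^ a)⁻¹ • applyLocal (A.map (fun p => p.eval ε)) (cycleState D L))
    (𝓝[≠] 0) (𝓝 ψ)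

/-- The translation-invariant bond dimension: the least `D` with `ψ ∈ TNS L D d`
(and `0` if there is none). -/
noncomputable def bond {L d : ℕ} (ψ : State (Fin d) L) : ℕ :=
  sInf {D | ψ ∈ TNS L D d}

/-- The translation-invariant border bond dimension: the least `D` such that `ψ` has a border
representation with bond dimension `D`, of any approximation degree (and `0` if there is
none). -/
noncomputable def borderBond {L d : ℕ} (ψ : State (Fin d) L) : ℕ :=
  sInf {D | ∃ (a : ℕ) (A : Matrix (Fin d) (Fin D × Fin D) ℂ[X]), IsBorderRep A a ψ}

/-- The word `2 1 0 1 0 … 1 0` of (odd) length `L`. -/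
def word (L : ℕ) : Fin L → Fin 3 :=
  fun j => if (j : ℕ) = 0 then 2 else if (j : ℕ) % 2 = 1 then 1 else 0

/-- `ψ_L = L^{-1/2} ∑_{i < L} S^i |2 1 0 1 0 … 1 0⟩`. -/
noncomputable def psi (L : ℕ) : State (Fin 3) L :=
  ((Real.sqrt L : ℝ) : ℂ)⁻¹ •
    ∑ i ∈ Finset.range L, ((shift (Fin 3) L)^[i]) (Pi.single (word L) 1)

end TIMPS

/-!
A configuration `s` has amplitude `tr (A (s 0) ⋯ A (s (L - 1)))` in the matrix product state with
site matrices `A 0, A 1, A 2`, so everything is about traces of words of length `L`.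

*Border representation.* The automaton `2 : 0 → 0`, `1 : 0 → 1`, `0 : 1 → 0` has a closed path of
odd length only if the letter `2` occurs, and with exactly one `2` the closed paths spell the
rotations of `2 1 0 ⋯ 1 0` (`exists_two_of_bondPair_closed`, `bondPair_closed_iff`). Weighting the
letter `2` by `ε` kills the paths with two or more such letters in the limit, and the weight state
does so exactly. Bond dimension at most one makes amplitudes invariant under all permutations of the
sites, which `psi` is not.

*Lower bound.* In an exact representation let `E = A 2` and `a = A 0 + A 1`. Then
`tr (E a ^ (L - 1)) = 1 / √L` (`trace_prefix_mul_pow`), while the trace vanishes on words of length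
`L` with at least two letters `E`. These facts are incompatible once `L ≥ 6 D ^ 3 + 3 D ^ 2 + D`
(`trace_letter_two_mul_pow_eq_zero`):

* Some invertible `b` commutes with `a` and agrees with it on the range of `a ^ D`
  (`exists_unit_pow_mul_eq`). Put `F = a ^ D E a ^ D`. Dividing a word of length `ℓ` in `b` and `F`
  by `b ^ ℓ` on the right makes words of different lengths comparable: prefixing a letter is a linear
  operator on matrices, so by a dimension count (`exists_invariant_le_ker`) the hypothesis on the
  words that fit into length `L` extends to words of every length, and then to negative powers of
  `b`.
* Hence, for `Q = b ^ L` and `g = F b ^ (-2 D - 1)`, the functional `tr (x Q)` vanishes on all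
  products of at least two conjugates `b ^ j g b ^ (-j)`. Such a functional vanishes at `g` as well
  (`trace_eq_zero_of_products`): modulo its radical the algebra generated by the conjugates is
  semisimple, so the ideal they generate is idempotent, and elements of the radical contribute
  nothing because the radical is nilpotent and stable under conjugation by `Q`. But
  `tr (g Q) = tr (E a ^ (L - 1))`.

A representation with bond dimension `L` exists (`psi_mem_TNS_self`), so the infimum defining the
bond dimension is attained.
-/

namespace TIMPS

/-! ### Conjugation and the Jacobson radical -/

/-- Conjugation `x ↦ u ^ j * x * u ^ (-j)`. -/
def conjPow {R : Type*} [Ring R] (u : Rˣ) (j : ℤ) (x : R) : R :=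
  ↑(u ^ j) * x * ↑(u ^ (-j))

theorem conjPow_conjPow {R : Type*} [Ring R] (u : Rˣ) (i j : ℤ) (x : R) :
    conjPow u i (conjPow u j x) = conjPow u (i + j) x := by
  have h : (-(i + j)) = -j + -i := by ring
  simp only [conjPow, h, zpow_add, Units.val_mul, mul_assoc]

theorem conjPow_zero {R : Type*} [Ring R] (u : Rˣ) (x : R) : conjPow u 0 x = x := by
  simp [conjPow]

theorem conjPow_mul {R : Type*} [Ring R] (u : Rˣ) (i : ℤ) (x y : R) :
    conjPow u i (x * y) = conjPow u i x * conjPow u i y := by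
  have : ((u ^ (-i) : Rˣ) : R) * ((u ^ i : Rˣ) : R) = 1 := by
    rw [← Units.val_mul, ← zpow_add]; simp
  simp only [conjPow, mul_assoc]
  rw [← mul_assoc (((u ^ (-i) : Rˣ) : R)) (((u ^ i : Rˣ) : R)), this, one_mul]

theorem ringEquiv_mem_jacobson {R : Type*} [Ring R] (f : R ≃+* R) {x : R}
    (hx : x ∈ Ring.jacobson R) : f x ∈ Ring.jacobson R := by
  have : RingHomSurjective (f : R →+* R) := ⟨f.surjective⟩
  exact Ring.le_comap_jacobson (f : R →+* R) hx

/-- A left ideal of a semiprimary ring contains a right identity for itself modulo the radical: it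
lifts the idempotent generating the image in the semisimple quotient. -/
theorem exists_sub_mul_mem_jacobson {R : Type*} [Ring R] [IsSemiprimaryRing R] (I : Ideal R) :
    ∃ e ∈ I, ∀ x ∈ I, x - x * e ∈ Ring.jacobson R := by
  obtain ⟨e', he', hI⟩ := IsSemisimpleRing.ideal_eq_span_idempotent
    (I.map (Ideal.Quotient.mk (Ring.jacobson R)))
  have hmem : e' ∈ I.map (Ideal.Quotient.mk (Ring.jacobson R)) := by
    rw [hI]; exact Ideal.mem_span_singleton_self e'
  obtain ⟨e, heI, he⟩ :=
    (Ideal.mem_map_iff_of_surjective _ Ideal.Quotient.mk_surjective).1 hmem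
  refine ⟨e, heI, fun x hx => ?_⟩
  have hx' := Ideal.mem_map_of_mem (Ideal.Quotient.mk (Ring.jacobson R)) hx
  rw [hI] at hx'
  obtain ⟨r, hr⟩ := Ideal.mem_span_singleton'.1 hx'
  rw [← Ideal.Quotient.eq_zero_iff_mem, map_sub, map_mul, he, ← hr, mul_assoc, he'.eq, sub_self]

/-- Conjugation by powers of `u` as an automorphism of a subalgebra it preserves. -/
def conjEquiv {A : Type*} [Ring A] [Algebra ℂ A] (u : Aˣ) (R : Subalgebra ℂ A)
    (hR : ∀ j : ℤ, ∀ x ∈ R, conjPow u j x ∈ R) (j : ℤ) : R ≃+* R where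
  toFun x := ⟨conjPow u j x, hR j x x.2⟩
  invFun x := ⟨conjPow u (-j) x, hR (-j) x x.2⟩
  left_inv x := by simp [conjPow_conjPow, conjPow_zero]
  right_inv x := by simp [conjPow_conjPow, conjPow_zero]
  map_mul' x y := by simp [conjPow_mul]
  map_add' x y := by
    ext1; simp [conjPow, mul_add, add_mul]

/-- If `R` is normalised by `u`, an element `x` of its radical satisfies
`(x u ^ n) ^ k = c u ^ (n k)` with `c` in the `k`-th power of the radical; hence `x u ^ n` is
nilpotent. -/
theorem isNilpotent_mul_of_mem_jacobson {A : Type*} [Ring A] [Algebra ℂ A]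
    [FiniteDimensional ℂ A] (u : Aˣ)
    (R : Subalgebra ℂ A) (hR : ∀ j : ℤ, ∀ x ∈ R, conjPow u j x ∈ R) (n : ℕ)
    (x : R) (hx : x ∈ Ring.jacobson R) : IsNilpotent ((x : A) * ↑(u ^ n)) := by
  have : IsArtinianRing R := IsArtinianRing.of_finite ℂ R
  obtain ⟨m, hm⟩ := IsSemiprimaryRing.isNilpotent (R := R)
  have key : ∀ k : ℕ, ∃ c ∈ Ring.jacobson R ^ k,
      ((x : A) * ↑(u ^ n)) ^ k = (c : A) * ↑(u ^ (n * k)) := by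
    intro k
    induction k with
    | zero => exact ⟨1, by rw [Submodule.pow_zero, Ideal.one_eq_top]; trivial, by simp⟩
    | succ k ih =>
      obtain ⟨c, hc, h⟩ := ih
      refine ⟨c * conjEquiv u R hR ((n * k : ℕ) : ℤ) x, ?_, ?_⟩
      · rw [Submodule.pow_succ]
        exact Ideal.mul_mem_mul hc (ringEquiv_mem_jacobson _ hx)
      · rw [pow_succ, h]
        have e : ((u ^ (-((n * k : ℕ) : ℤ)) : Aˣ) : A) * ((u ^ (n * (k + 1)) : Aˣ) : A)
            = ((u ^ n : Aˣ) : A) := by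
          rw [← Units.val_mul, ← zpow_natCast, ← zpow_add, ← zpow_natCast]
          congr 2; push_cast; ring
        simp only [conjEquiv, RingEquiv.coe_mk, Equiv.coe_fn_mk, conjPow, MulMemClass.coe_mul,
          mul_assoc, e, zpow_natCast]
  obtain ⟨c, hc, h⟩ := key m
  rw [hm] at hc
  have hc0 : c = 0 := by simpa using hc
  exact ⟨m, by rw [h, hc0]; simp⟩

/-- Let `Q` be a power of the invertible matrix `b`. If `tr (x Q)` vanishes on all products of at
least two conjugates `b ^ j g b ^ (-j)`, then `tr (g Q) = 0`. In the algebra `R` generated by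
the conjugates, the left ideal they generate contains an `e` with `g - g e` in the radical of `R`;
there `(g - g e) Q` is nilpotent, and `g e` is a sum of products of at least two conjugates. -/
theorem trace_eq_zero_of_products {D : ℕ}
    (b : (Matrix (Fin D) (Fin D) ℂ)ˣ) (g : Matrix (Fin D) (Fin D) ℂ) (n : ℕ)
    (h : ∀ l : List ℤ, 2 ≤ l.length →
      ((l.map fun j => conjPow b j g).prod * (↑(b ^ n) : Matrix (Fin D) (Fin D) ℂ)).trace = 0) :
    (g * (↑(b ^ n) : Matrix (Fin D) (Fin D) ℂ)).trace = 0 := by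
  set S : Set (Matrix (Fin D) (Fin D) ℂ) := Set.range fun j : ℤ => conjPow b j g with hS
  set R := Algebra.adjoin ℂ S with hRdef
  have hprod : ∀ x ∈ Submonoid.closure S, ∃ l : List ℤ, x = (l.map fun j => conjPow b j g).prod := by
    intro x hx
    induction hx using Submonoid.closure_induction with
    | mem x hx => obtain ⟨j, rfl⟩ := hx; exact ⟨[j], by simp⟩
    | one => exact ⟨[], by simp⟩
    | mul x y _ _ hx hy =>
      obtain ⟨l, rfl⟩ := hx
      obtain ⟨l', rfl⟩ := hy
      exact ⟨l ++ l', by simp⟩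
  have hR : ∀ j : ℤ, ∀ x ∈ R, conjPow b j x ∈ R := by
    intro j x hx
    induction hx using Algebra.adjoin_induction with
    | mem x hx =>
      obtain ⟨i, rfl⟩ := hx
      exact Algebra.subset_adjoin ⟨j + i, (conjPow_conjPow b j i g).symm⟩
    | algebraMap r =>
      have : conjPow b j (algebraMap ℂ (Matrix (Fin D) (Fin D) ℂ) r) = algebraMap ℂ _ r := by
        rw [conjPow, ← Algebra.commutes, mul_assoc, ← Units.val_mul, ← zpow_add]; simp
      rw [this]; exact R.algebraMap_mem r
    | add x y _ _ hx hy =>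
      have : conjPow b j (x + y) = conjPow b j x + conjPow b j y := by
        simp [conjPow, mul_add, add_mul]
      rw [this]; exact R.add_mem hx hy
    | mul x y _ _ hx hy => rw [conjPow_mul]; exact R.mul_mem hx hy
  have hgS : g ∈ S := ⟨0, conjPow_zero b g⟩
  have hgR : g ∈ R := Algebra.subset_adjoin hgS
  have : IsArtinianRing R := IsArtinianRing.of_finite ℂ R
  obtain ⟨e, heI, he⟩ := exists_sub_mul_mem_jacobson
    (Ideal.span {x : R | (x : Matrix (Fin D) (Fin D) ℂ) ∈ S})
  -- products `g r t` with `t` a generator are sums of products of at least two generators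
  have hgrt : ∀ r ∈ R, ∀ t ∈ S, (g * (r * t) * (↑(b ^ n) : Matrix (Fin D) (Fin D) ℂ)).trace = 0 := by
    intro r hr t ht
    rw [hRdef, ← Subalgebra.mem_toSubmodule, Algebra.adjoin_eq_span] at hr
    induction hr using Submodule.span_induction with
    | mem x hx =>
      obtain ⟨l, rfl⟩ := hprod x hx
      obtain ⟨j, rfl⟩ := ht
      have := h (0 :: (l ++ [j])) (by simp)
      simpa [conjPow_zero, mul_assoc] using this
    | zero => simp
    | add x y _ _ hx hy => simp [add_mul, mul_add, hx, hy, -Units.val_pow_eq_pow_val]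
    | smul c x _ hx => simp [hx, -Units.val_pow_eq_pow_val]
  have hge : (g * (e : Matrix (Fin D) (Fin D) ℂ) *
      (↑(b ^ n) : Matrix (Fin D) (Fin D) ℂ)).trace = 0 := by
    refine Submodule.span_induction
      (p := fun (y : R) _ => ∀ r ∈ R, (g * (r * (y : Matrix (Fin D) (Fin D) ℂ)) *
        (↑(b ^ n) : Matrix (Fin D) (Fin D) ℂ)).trace = 0)
      ?_ ?_ ?_ ?_ heI 1 R.one_mem |> fun h => by simpa using h
    · intro t ht r hr; exact hgrt r hr t ht
    · intro r _; simp
    · intro x y _ _ hx hy r hr; simp [mul_add, add_mul, hx r hr, hy r hr, -Units.val_pow_eq_pow_val]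
    · intro c x _ hx r hr
      have := hx (r * c) (R.mul_mem hr c.2)
      simpa [mul_assoc] using this
  have hnil := isNilpotent_mul_of_mem_jacobson b R hR n _
    (he ⟨g, hgR⟩ (Ideal.subset_span hgS))
  have h0 := (Matrix.isNilpotent_trace_of_isNilpotent hnil).eq_zero
  have h1 : (((⟨g, hgR⟩ - ⟨g, hgR⟩ * e : R) : Matrix (Fin D) (Fin D) ℂ) *
      (↑(b ^ n) : Matrix (Fin D) (Fin D) ℂ)).trace
      = (g * (↑(b ^ n) : Matrix (Fin D) (Fin D) ℂ)).trace - (g * (e : Matrix (Fin D) (Fin D) ℂ) * (↑(b ^ n) : Matrix (Fin D) (Fin D) ℂ)).trace := by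
    rw [← Matrix.trace_sub, ← sub_mul]; rfl
  rw [h1, hge, sub_zero] at h0
  exact h0
/-! ### Reachable subspaces -/

/-- Cyclic submodules stabilise after `dim` steps: a functional that vanishes on `T_w v` for
all words `w` of length at most the dimension vanishes on an invariant subspace containing `v`. -/
theorem exists_invariant_le_ker {K X ι : Type*} [Field K] [AddCommGroup X] [Module K X]
    [FiniteDimensional K X] (T : ι → Module.End K X) (v : X) (f : X →ₗ[K] K)
    (h : ∀ w : List ι, w.length ≤ Module.finrank K X → f ((w.map T).prod v) = 0) :
    ∃ U : Submodule K X, v ∈ U ∧ (∀ i, ∀ x ∈ U, T i x ∈ U) ∧ ∀ x ∈ U, f x = 0 := by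
  set U : ℕ → Submodule K X := fun k =>
    Submodule.span K {x | ∃ w : List ι, w.length ≤ k ∧ x = (w.map T).prod v} with hU
  have hv : ∀ k, v ∈ U k := fun k => Submodule.subset_span ⟨[], by simp, by simp⟩
  have hmono : ∀ k, U k ≤ U (k + 1) := fun k =>
    Submodule.span_mono fun x ⟨w, hw, hx⟩ => ⟨w, hw.trans (Nat.le_succ k), hx⟩
  have hstep : ∀ k i, ∀ x ∈ U k, T i x ∈ U (k + 1) := by
    intro k i x hx
    induction hx using Submodule.span_induction with
    | mem x hx =>
      obtain ⟨w, hw, rfl⟩ := hx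
      exact Submodule.subset_span ⟨i :: w, by simpa using hw, by simp⟩
    | zero => simp
    | add x y _ _ hx hy => rw [map_add]; exact Submodule.add_mem _ hx hy
    | smul c x _ hx => rw [map_smul]; exact Submodule.smul_mem _ c hx
  obtain ⟨k, hk, hkU⟩ : ∃ k ≤ Module.finrank K X, U (k + 1) = U k := by
    by_contra! hne
    have hlt : ∀ k ≤ Module.finrank K X + 1, k ≤ Module.finrank K (U k) := by
      intro k
      induction k with
      | zero => simp
      | succ k ih =>
        intro hk
        have := Submodule.finrank_lt_finrank_of_lt
          ((hmono k).lt_of_ne (hne k (by omega)).symm)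
        have := ih (by omega)
        omega
    have := hlt _ le_rfl
    have := (U (Module.finrank K X + 1)).finrank_le
    omega
  refine ⟨U k, hv k, fun i x hx => hkU ▸ hstep k i x hx, fun x hx => ?_⟩
  induction hx using Submodule.span_induction with
  | mem x hx => obtain ⟨w, hw, rfl⟩ := hx; exact h w (hw.trans hk)
  | zero => simp
  | add x y _ _ hx hy => rw [map_add, hx, hy, add_zero]
  | smul c x _ hx => rw [map_smul, hx, smul_zero]

/-- A finite-dimensional subspace stable under an injective endomorphism is stable under taking
preimages. -/
theorem mem_of_map_mem {K X : Type*} [Field K] [AddCommGroup X] [Module K X]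
    [FiniteDimensional K X] (T : Module.End K X) (hT : Function.Injective T) (U : Submodule K X)
    (hU : ∀ x ∈ U, T x ∈ U) {x : X} (hx : T x ∈ U) : x ∈ U := by
  have hle : U.map T ≤ U := by rintro _ ⟨y, hy, rfl⟩; exact hU y hy
  have : U.map T = U := Submodule.eq_of_le_of_finrank_eq hle
    (LinearEquiv.finrank_eq (Submodule.equivMapOfInjective T hT U)).symm
  rw [← this] at hx
  obtain ⟨y, hy, hxy⟩ := hx
  exact hT hxy ▸ hy

/-! ### An invertible substitute for a matrix -/

/-- A square matrix `a` has an invertible `b` commuting with it that agrees with `a` on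
the range of `a ^ D`: if the characteristic polynomial is `X ^ k * u` with `u 0 ≠ 0`, take
`b = a + u(a)`. -/
theorem exists_unit_pow_mul_eq {D : ℕ} (a : Matrix (Fin D) (Fin D) ℂ) :
    ∃ b : (Matrix (Fin D) (Fin D) ℂ)ˣ,
      Commute a (b : Matrix (Fin D) (Fin D) ℂ) ∧ a ^ D * (b : Matrix (Fin D) (Fin D) ℂ) = a ^ (D + 1) := by
  obtain ⟨u, hu, hX⟩ := Polynomial.exists_eq_pow_rootMultiplicity_mul_and_not_dvd a.charpoly
    a.charpoly_monic.ne_zero 0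
  set k := Polynomial.rootMultiplicity 0 a.charpoly
  rw [C_0, sub_zero] at hu hX
  have hk : k ≤ D := by
    have h1 := Polynomial.natDegree_le_of_dvd (Dvd.intro _ hu.symm) a.charpoly_monic.ne_zero
    simpa [Matrix.charpoly_natDegree_eq_dim] using h1
  have hcop : IsCoprime X u := (Polynomial.irreducible_X.coprime_iff_not_dvd).2 hX
  have h1 : IsCoprime (X + u) a.charpoly := by
    rw [hu]
    refine IsCoprime.mul_right (IsCoprime.pow_right ?_) ?_
    · simpa [add_comm] using hcop.symm.add_mul_left_left 1
    · simpa using hcop.add_mul_left_left 1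
  obtain ⟨p, q, hpq⟩ := h1
  have h2 : aeval a p * aeval a (X + u) = 1 := by
    have := congrArg (aeval a) hpq
    simpa [Matrix.aeval_self_charpoly] using this
  have h3 : aeval a (X + u) * aeval a p = 1 := by rw [← h2, ← map_mul, ← map_mul, mul_comm]
  refine ⟨⟨aeval a (X + u), aeval a p, h3, h2⟩, ?_, ?_⟩
  · show Commute a (aeval a (X + u))
    have := Commute.all (X : ℂ[X]) (X + u)
    simpa using this.map (aeval a)
  · show a ^ D * aeval a (X + u) = _
    have h4 : a ^ D * aeval a u = 0 := by
      have h5 : aeval a (X ^ k * u) = 0 := by rw [← hu]; exact Matrix.aeval_self_charpoly a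
      have h6 : a ^ D = a ^ (D - k) * a ^ k := by rw [← pow_add]; congr 1; omega
      rw [map_mul, map_pow, aeval_X] at h5
      rw [h6, mul_assoc, h5, mul_zero]
    rw [map_add, aeval_X, mul_add, h4, add_zero, pow_succ]

/-! ### Spans of words with a prescribed number of letters -/

/-- The span of the products of `ℓ` letters among `A 0, A 1, A 2` in which `A 2` occurs at least
`m` times. -/
def wordSpan {D : ℕ} (A : Fin 3 → Matrix (Fin D) (Fin D) ℂ) (ℓ m : ℕ) :
    Submodule ℂ (Matrix (Fin D) (Fin D) ℂ) :=
  Submodule.span ℂ {x | ∃ w : List (Fin 3), w.length = ℓ ∧ m ≤ w.count 2 ∧ x = (w.map A).prod}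

section WordSpan

variable {D : ℕ} {A : Fin 3 → Matrix (Fin D) (Fin D) ℂ}

theorem list_prod_mem_wordSpan (w : List (Fin 3)) {m : ℕ} (hm : m ≤ w.count 2) :
    (w.map A).prod ∈ wordSpan A w.length m :=
  Submodule.subset_span ⟨w, rfl, hm, rfl⟩

theorem mul_mem_wordSpan {ℓ ℓ' m m' : ℕ} {x y : Matrix (Fin D) (Fin D) ℂ}
    (hx : x ∈ wordSpan A ℓ m) (hy : y ∈ wordSpan A ℓ' m') :
    x * y ∈ wordSpan A (ℓ + ℓ') (m + m') := by
  have h := Submodule.mul_mem_mul hx hy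
  rw [wordSpan, wordSpan, Submodule.span_mul_span] at h
  refine Submodule.span_mono ?_ h
  rintro _ ⟨_, ⟨w, hw, hm, rfl⟩, _, ⟨w', hw', hm', rfl⟩, rfl⟩
  refine ⟨w ++ w', by simp [hw, hw'], ?_, by simp⟩
  rw [List.count_append]
  omega

theorem wordSpan_anti {ℓ m m' : ℕ} (h : m ≤ m') : wordSpan A ℓ m' ≤ wordSpan A ℓ m :=
  Submodule.span_mono fun _ ⟨w, hw, hm, hx⟩ => ⟨w, hw, h.trans hm, hx⟩

theorem letter_mem_wordSpan (s : Fin 3) : A s ∈ wordSpan A 1 0 := by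
  simpa using list_prod_mem_wordSpan (A := A) [s] (Nat.zero_le _)

theorem letter_two_mem_wordSpan : A 2 ∈ wordSpan A 1 1 := by
  simpa using list_prod_mem_wordSpan (A := A) [2] (m := 1) (by simp)

theorem pow_mem_wordSpan {x : Matrix (Fin D) (Fin D) ℂ} (hx : x ∈ wordSpan A 1 0) (n : ℕ) :
    x ^ n ∈ wordSpan A n 0 := by
  induction n with
  | zero => exact Submodule.subset_span ⟨[], rfl, Nat.zero_le _, by simp⟩
  | succ n ih => rw [pow_succ]; simpa only [add_zero] using mul_mem_wordSpan ih hx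

end WordSpan

/-! ### Triples counting the factors of one kind -/

/-- Left multiplication by `F` combined with right multiplication by `G`, on triples indexed by
the number `0`, `1`, `≥ 2` of factors `F` used so far; the operator moves each entry to
the next index. -/
def countShift {M : Type*} [Ring M] [Algebra ℂ M] (F G : M) : Module.End ℂ (M × M × M) where
  toFun y := (0, F * (y.1 * G), F * ((y.2.1 + y.2.2) * G))
  map_add' x y := by
    ext <;> simp only [Prod.fst_add, Prod.snd_add, add_zero, mul_add, add_mul]
    abel
  map_smul' c x := by
    ext <;> simp [mul_add, add_mul]

theorem countShift_apply {M : Type*} [Ring M] [Algebra ℂ M] (F G : M) (y : M × M × M) :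
    countShift F G y = (0, F * (y.1 * G), F * ((y.2.1 + y.2.2) * G)) := rfl

/-- Conjugation by `u ^ j` in each entry of a triple. -/
def conjTriple {M : Type*} [Ring M] [Algebra ℂ M] (u : Mˣ) (j : ℤ) : Module.End ℂ (M × M × M) where
  toFun y := (conjPow u j y.1, conjPow u j y.2.1, conjPow u j y.2.2)
  map_add' x y := by ext <;> simp [conjPow, mul_add, add_mul]
  map_smul' c x := by ext <;> simp [conjPow]

theorem conjTriple_apply {M : Type*} [Ring M] [Algebra ℂ M] (u : Mˣ) (j : ℤ) (y : M × M × M) :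
    conjTriple u j y = (conjPow u j y.1, conjPow u j y.2.1, conjPow u j y.2.2) := rfl

theorem conjTriple_conjTriple {M : Type*} [Ring M] [Algebra ℂ M] (u : Mˣ) (i j : ℤ)
    (y : M × M × M) : conjTriple u i (conjTriple u j y) = conjTriple u (i + j) y := by
  simp [conjTriple_apply, conjPow_conjPow]

/-- A finite-dimensional space of triples stable under conjugation by `u` is stable under
conjugation by every integer power of `u`. -/
theorem conjTriple_mem {M : Type*} [Ring M] [Algebra ℂ M] [FiniteDimensional ℂ M] (u : Mˣ)
    (U : Submodule ℂ (M × M × M)) (hU : ∀ x ∈ U, conjTriple u 1 x ∈ U) (j : ℤ) {x : M × M × M}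
    (hx : x ∈ U) : conjTriple u j x ∈ U := by
  have hinj : Function.Injective (conjTriple u 1) := by
    refine Function.LeftInverse.injective (g := conjTriple u (-1)) fun y => ?_
    rw [conjTriple_conjTriple]
    simp [conjTriple_apply, conjPow_zero]
  induction j with
  | zero => simpa [conjTriple_apply, conjPow_zero] using hx
  | succ i ih =>
    have := hU _ ih
    rwa [conjTriple_conjTriple, add_comm] at this
  | pred i ih =>
    refine mem_of_map_mem _ hinj U hU ?_
    rw [conjTriple_conjTriple]
    simpa using ih

/-- A subspace containing `(1, 0, 0)` and stable under conjugation by `u` and under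
`y ↦ F y u ^ (-k)` with the shift of indices contains, at the last index, every product of at least
two conjugates `u ^ j g u ^ (-j)` of `g = F u ^ (-k)`. -/
theorem products_mem {M : Type*} [Ring M] [Algebra ℂ M] [FiniteDimensional ℂ M] (u : Mˣ)
    (F : M) (k : ℕ) (U : Submodule ℂ (M × M × M)) (h1 : (1, 0, 0) ∈ U)
    (hU : ∀ x ∈ U, conjTriple u 1 x ∈ U)
    (hF : ∀ x ∈ U, countShift F ((u ^ (-(k : ℤ)) : Mˣ) : M) x ∈ U) (l : List ℤ)
    (hl : 2 ≤ l.length) :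
    (0, 0, (l.map fun j => conjPow u j (F * ((u ^ (-(k : ℤ)) : Mˣ) : M))).prod) ∈ U := by
  -- left multiplication by a conjugate of `g = F u ^ (-k)` is a composite of the given operators
  have hS : ∀ j : ℤ, ∀ y ∈ U,
      countShift (conjPow u j (F * ((u ^ (-(k : ℤ)) : Mˣ) : M))) 1 y ∈ U := by
    intro j y hy
    have h := conjTriple_mem u U hU j (hF _ (conjTriple_mem u U hU (-(k + j)) hy))
    have e : ∀ z : M, conjPow u j (F * (conjPow u (-(k + j)) z * ((u ^ (-(k : ℤ)) : Mˣ) : M)))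
        = conjPow u j (F * ((u ^ (-(k : ℤ)) : Mˣ) : M)) * (z * 1) := by
      intro z
      have e1 : (u ^ (-(k + j) : ℤ) : Mˣ) = u ^ (-(k : ℤ)) * u ^ (-j) := by
        rw [← zpow_add]; congr 1; ring
      have e2 : ((u ^ (-(-(k + j)) : ℤ) : Mˣ) : M) * (((u ^ (-(k : ℤ)) : Mˣ) : M) *
          ((u ^ (-j) : Mˣ) : M)) = 1 := by
        rw [← Units.val_mul, ← Units.val_mul, ← zpow_add, ← zpow_add]
        rw [show -(-((k : ℤ) + j)) + (-(k : ℤ) + -j) = 0 by ring]; simp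
      simp only [conjPow, mul_assoc, mul_one]
      rw [e2, e1]
      simp only [Units.val_mul, mul_assoc, mul_one]
    have e0 : conjPow u j (0 : M) = 0 := by simp [conjPow]
    have e3 : ∀ x z : M, conjPow u j (x + z) = conjPow u j x + conjPow u j z := by
      intro x z; simp [conjPow, mul_add, add_mul]
    simp only [conjTriple_apply, countShift_apply, e0, e, add_mul, mul_add, e3] at h
    simpa only [countShift_apply, add_mul, mul_add] using h
  suffices H : ∀ l : List ℤ,
      (let p := (l.map fun j => conjPow u j (F * ((u ^ (-(k : ℤ)) : Mˣ) : M))).prod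
       ((if l.length = 0 then p else 0, if l.length = 1 then p else 0,
        if 2 ≤ l.length then p else 0) : M × M × M)) ∈ U by
    have := H l
    simpa [hl, show l ≠ [] by rintro rfl; simp at hl, show l.length ≠ 1 by omega] using this
  intro l
  induction l with
  | nil => simpa using h1
  | cons j l ih =>
    have h := hS j _ ih
    rw [countShift_apply] at h
    rcases l with _ | ⟨i, _ | ⟨i', l⟩⟩
    · simpa using h
    · simpa using h
    · simpa using h

/-! ### Traces of long words -/

/-- If the trace vanishes on all words of length `L` with at least two letters `A 2`, and `L` is
large compared to `D ^ 3`, then it vanishes on `A 2 * a ^ (L - 1)` for every combination `a` of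
letters. With `b` the invertible substitute for `a` and `F = a ^ D * A 2 * a ^ D`, dividing a word
of length `ℓ` in `b` and `F` by `b ^ ℓ` removes the length constraint: on a space of dimension
`3 * D ^ 2` the words with at most `3 * D ^ 2` letters, all of total length at most `L - D`, already
span everything reachable. -/
theorem trace_letter_two_mul_pow_eq_zero {D L : ℕ} (A : Fin 3 → Matrix (Fin D) (Fin D) ℂ)
    (hL : 3 * D ^ 2 * (2 * D + 1) + D ≤ L)
    (h : ∀ x ∈ wordSpan A L 2, x.trace = 0) (a : Matrix (Fin D) (Fin D) ℂ)
    (ha : a ∈ wordSpan A 1 0) : (A 2 * a ^ (L - 1)).trace = 0 := by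
  rcases Nat.eq_zero_or_pos D with rfl | hD
  · simp [Matrix.trace]
  obtain ⟨b, hab, hb⟩ := exists_unit_pow_mul_eq a
  set k := 2 * D + 1 with hk
  set F := a ^ D * A 2 * a ^ D with hF
  set B := ((b ^ (-(k : ℤ)) : (Matrix (Fin D) (Fin D) ℂ)ˣ) : Matrix (Fin D) (Fin D) ℂ) with hB
  set bb : Matrix (Fin D) (Fin D) ℂ := b.val with hbb
  have hBb : B * bb ^ k = 1 := by
    rw [hB, hbb, ← Units.val_pow_eq_pow_val, ← Units.val_mul, ← zpow_natCast, ← zpow_add]; simp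
  have hba : bb * a ^ D = a * a ^ D := by
    rw [← (hab.pow_left D).eq, hb, pow_succ']
  have hpow : ∀ n, a ^ D * bb ^ n = a ^ D * a ^ n := by
    intro n
    induction n with
    | zero => simp
    | succ n ih =>
      rw [pow_succ, ← mul_assoc, ih, mul_assoc, ((hab.pow_left n).eq), ← mul_assoc, hb, ← pow_add,
        ← pow_add]
      congr 1; ring
  have hkL : k ≤ L := by nlinarith [hL, Nat.pow_pos hD (n := 2)]
  have hFmem : F ∈ wordSpan A k 1 := by
    have := mul_mem_wordSpan (mul_mem_wordSpan (pow_mem_wordSpan ha D)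
      (letter_two_mem_wordSpan (A := A))) (pow_mem_wordSpan ha D)
    rw [show k = D + 1 + D by omega]
    simpa using this
  -- `y` is a word of length `ℓ` with at least `m` letters `F`, divided by `b ^ ℓ`; on the range
  -- of `a ^ D` the matrix `b` may be replaced by the letter combination `a`
  let good : ℕ → ℕ → Matrix (Fin D) (Fin D) ℂ → Prop := fun ℓ m y =>
    (∃ z, y * bb ^ ℓ * a ^ D = a ^ D * z) ∧ y * bb ^ ℓ * a ^ D ∈ wordSpan A (ℓ + D) m
  have good_zero : ∀ ℓ m, good ℓ m 0 := fun ℓ m => ⟨⟨0, by simp⟩, by simp⟩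
  have good_add : ∀ {ℓ m x y}, good ℓ m x → good ℓ m y → good ℓ m (x + y) := by
    rintro ℓ m x y ⟨⟨z, hz⟩, hx⟩ ⟨⟨z', hz'⟩, hy⟩
    refine ⟨⟨z + z', by rw [mul_add, ← hz, ← hz', add_mul, add_mul]⟩, ?_⟩
    rw [add_mul, add_mul]; exact Submodule.add_mem _ hx hy
  have good_conj : ∀ {ℓ m y}, good ℓ m y → good (ℓ + 1) m (conjPow b 1 y) := by
    rintro ℓ m y ⟨⟨z, hz⟩, hy⟩
    have e : conjPow b 1 y * bb ^ (ℓ + 1) * a ^ D = a * (y * bb ^ ℓ * a ^ D) := by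
      have e1 : ((b ^ (-1 : ℤ) : (Matrix (Fin D) (Fin D) ℂ)ˣ) : Matrix (Fin D) (Fin D) ℂ) * bb = 1 := by
        simp [hbb]
      calc conjPow b 1 y * bb ^ (ℓ + 1) * a ^ D
          = bb * y * (((b ^ (-1 : ℤ) : (Matrix (Fin D) (Fin D) ℂ)ˣ) :
              Matrix (Fin D) (Fin D) ℂ) * bb) * bb ^ ℓ * a ^ D := by
            rw [conjPow, zpow_one, pow_succ']; simp only [mul_assoc, hbb]
        _ = bb * (y * bb ^ ℓ * a ^ D) := by rw [e1]; simp only [mul_assoc, mul_one]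
        _ = a * (y * bb ^ ℓ * a ^ D) := by rw [hz, ← mul_assoc, hba, mul_assoc]
    refine ⟨⟨a * z, by rw [e, hz, ← mul_assoc, ← pow_succ', pow_succ, mul_assoc]⟩, ?_⟩
    rw [e, show ℓ + 1 + D = 1 + (ℓ + D) by ring]
    simpa using mul_mem_wordSpan ha hy
  have good_F : ∀ {ℓ m y}, good ℓ m y → good (ℓ + k) (m + 1) (F * (y * B)) := by
    rintro ℓ m y ⟨-, hy⟩
    have e : F * (y * B) * bb ^ (ℓ + k) * a ^ D = F * (y * bb ^ ℓ * a ^ D) := by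
      calc F * (y * B) * bb ^ (ℓ + k) * a ^ D = F * y * (B * bb ^ k) * bb ^ ℓ * a ^ D := by
            rw [add_comm ℓ k, pow_add]; simp only [mul_assoc]
        _ = _ := by rw [hBb]; simp only [mul_assoc, one_mul]
    refine ⟨⟨A 2 * a ^ D * (y * bb ^ ℓ * a ^ D), by rw [e, hF]; simp only [mul_assoc]⟩, ?_⟩
    rw [e, show ℓ + k + D = k + (ℓ + D) by ring, add_comm m 1]
    exact mul_mem_wordSpan hFmem hy
  have good_anti : ∀ {ℓ m m' y}, m ≤ m' → good ℓ m' y → good ℓ m y :=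
    fun hm hy => ⟨hy.1, wordSpan_anti hm hy.2⟩
  let T : Bool → Module.End ℂ (Matrix (Fin D) (Fin D) ℂ × Matrix (Fin D) (Fin D) ℂ ×
    Matrix (Fin D) (Fin D) ℂ) := fun c => if c then countShift F B else conjTriple b 1
  have hword : ∀ w : List Bool, ∃ ℓ ≤ w.length * k,
      good ℓ 0 ((w.map T).prod (1, 0, 0)).1 ∧ good ℓ 1 ((w.map T).prod (1, 0, 0)).2.1 ∧
        good ℓ 2 ((w.map T).prod (1, 0, 0)).2.2 := by
    intro w
    induction w with
    | nil =>
      refine ⟨0, by simp, ?_, by simpa using good_zero 0 1, by simpa using good_zero 0 2⟩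
      exact ⟨⟨1, by simp⟩, by simpa using pow_mem_wordSpan ha D⟩
    | cons c w ih =>
      obtain ⟨ℓ, hℓ, h0, h1, h2⟩ := ih
      set y := (w.map T).prod (1, 0, 0) with hy
      have hcons : (((c :: w).map T).prod (1, 0, 0)) = T c y := by simp [hy]
      rw [hcons]
      cases c with
      | false =>
        refine ⟨ℓ + 1, ?_, ?_⟩
        · rw [List.length_cons, add_mul]; omega
        · have hT : T false y = _ := conjTriple_apply b 1 y
          rw [hT]
          exact ⟨good_conj h0, good_conj h1, good_conj h2⟩
      | true =>
        refine ⟨ℓ + k, ?_, ?_⟩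
        · rw [List.length_cons, add_mul]; omega
        · have hT : T true y = _ := countShift_apply F B y
          rw [hT]
          exact ⟨good_zero _ _, good_F h0, good_F (good_add h1 (good_anti one_le_two h2))⟩
  let f : (Matrix (Fin D) (Fin D) ℂ × Matrix (Fin D) (Fin D) ℂ × Matrix (Fin D) (Fin D) ℂ)
      →ₗ[ℂ] ℂ := Matrix.traceLinearMap (Fin D) ℂ ℂ ∘ₗ
    LinearMap.mulRight ℂ (bb ^ (L - D) * a ^ D) ∘ₗ LinearMap.snd ℂ _ _ ∘ₗ LinearMap.snd ℂ _ _
  have hdim : Module.finrank ℂ (Matrix (Fin D) (Fin D) ℂ × Matrix (Fin D) (Fin D) ℂ ×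
      Matrix (Fin D) (Fin D) ℂ) = 3 * D ^ 2 := by
    simp [Module.finrank_prod, Module.finrank_matrix]; ring
  obtain ⟨U, h1U, hTU, hfU⟩ := exists_invariant_le_ker T (1, 0, 0) f (by
    intro w hw
    rw [hdim] at hw
    obtain ⟨ℓ, hℓ, -, -, -, h2⟩ := hword w
    have hℓL : ℓ + D ≤ L := by nlinarith [Nat.mul_le_mul_right k hw]
    set y := ((w.map T).prod (1, 0, 0)).2.2
    show (y * (bb ^ (L - D) * a ^ D)).trace = 0
    have e : y * (bb ^ (L - D) * a ^ D) = y * bb ^ ℓ * a ^ D * a ^ (L - D - ℓ) := by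
      rw [mul_assoc (y * bb ^ ℓ), ← hpow, ((hab.symm.pow_pow _ _).eq.symm : a ^ D * bb ^ _ = _),
        mul_assoc y, ← mul_assoc (bb ^ ℓ), ← pow_add]
      congr 4; omega
    rw [e]
    refine h _ ?_
    have := mul_mem_wordSpan h2 (pow_mem_wordSpan ha (L - D - ℓ))
    rwa [show ℓ + D + (L - D - ℓ) = L by omega] at this)
  have hprod := trace_eq_zero_of_products b (F * B) L (by
    intro l hl
    have hmem := products_mem b F k U h1U (fun x hx => hTU false x hx) (fun x hx => hTU true x hx)
      l hl
    have h0 : ((l.map fun j => conjPow b j (F * B)).prod * (bb ^ (L - D) * a ^ D)).trace = 0 :=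
      hfU _ hmem
    -- each factor absorbs `a ^ D` and `b ^ D` in the same way
    have hFD : F * a ^ D = F * bb ^ D := by
      rw [hF, mul_assoc _ (a ^ D) (bb ^ D), hpow, mul_assoc]
    have hconj : ∀ j : ℤ, conjPow b j (F * B) * a ^ D = conjPow b j (F * B) * bb ^ D := by
      intro j
      have hcom : ∀ (i : ℤ), Commute (a ^ D) ((b ^ i : (Matrix (Fin D) (Fin D) ℂ)ˣ) :
          Matrix (Fin D) (Fin D) ℂ) := fun i => (hab.pow_left D).units_zpow_right i
      have hcom' : ∀ (i : ℤ), Commute (bb ^ D) ((b ^ i : (Matrix (Fin D) (Fin D) ℂ)ˣ) :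
          Matrix (Fin D) (Fin D) ℂ) := fun i =>
        ((Commute.refl bb).pow_left D).units_zpow_right i
      simp only [conjPow, hB, mul_assoc]
      rw [← (hcom _).eq, ← (hcom' _).eq]
      simp only [← mul_assoc _ (a ^ D), ← mul_assoc _ (bb ^ D)]
      rw [← (hcom _).eq, ← (hcom' _).eq]
      simp only [← mul_assoc]
      simp only [mul_assoc _ F, hFD]
    have hlist : ∀ l : List ℤ, l ≠ [] → (l.map fun j => conjPow b j (F * B)).prod * a ^ D
        = (l.map fun j => conjPow b j (F * B)).prod * bb ^ D := by
      intro l hl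
      obtain ⟨l', j, rfl⟩ := List.eq_nil_or_concat l |>.resolve_left hl
      simp only [List.concat_eq_append, List.map_append, List.prod_append, List.map_cons,
        List.map_nil, List.prod_singleton, mul_assoc, hconj]
    have hDL : D ≤ L := by omega
    have hbL : ((b ^ L : (Matrix (Fin D) (Fin D) ℂ)ˣ) : Matrix (Fin D) (Fin D) ℂ)
        = bb ^ D * bb ^ (L - D) := by
      rw [Units.val_pow_eq_pow_val, ← pow_add, Nat.add_sub_cancel' hDL]
    rw [← h0, hbL, ((hab.pow_left D).pow_right (L - D)).eq.symm]
    simp only [← mul_assoc (List.prod _)]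
    rw [hlist l (by rintro rfl; simp at hl)])
  have e : F * B * ((b ^ L : (Matrix (Fin D) (Fin D) ℂ)ˣ) : Matrix (Fin D) (Fin D) ℂ)
      = a ^ D * (A 2 * a ^ (L - 1 - D)) := by
    rw [Units.val_pow_eq_pow_val, ← Nat.add_sub_cancel' hkL, pow_add, mul_assoc, ← mul_assoc B,
      hBb, one_mul, hF, mul_assoc, hpow, mul_assoc, ← pow_add]
    congr 3; omega
  rw [e, Matrix.trace_mul_comm, mul_assoc, ← pow_add, Nat.sub_add_cancel (by omega)] at hprod
  exact hprod

/-! ### Amplitudes of matrix product states -/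

/-- Entries of a product of `n + 1` matrices as a sum over paths with `n` inner vertices. -/
theorem list_prod_ofFn_apply {D : ℕ} : ∀ (n : ℕ) (M : Fin (n + 1) → Matrix (Fin D) (Fin D) ℂ)
    (i j : Fin D), (List.ofFn M).prod i j =
      ∑ p : Fin n → Fin D, ∏ k, M k ((Fin.cons i p : Fin (n + 1) → Fin D) k)
        ((Fin.snoc p j : Fin (n + 1) → Fin D) k)
  | 0, M, i, j => by simp [Fin.snoc]
  | n + 1, M, i, j => by
    rw [List.ofFn_succ, List.prod_cons, Matrix.mul_apply,
      ← (Fin.consEquiv fun _ => Fin D).sum_comp, Fintype.sum_prod_type]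
    refine Finset.sum_congr rfl fun q _ => ?_
    rw [list_prod_ofFn_apply n, Finset.mul_sum]
    refine Finset.sum_congr rfl fun p _ => ?_
    rw [Fin.prod_univ_succ (n := n + 1)]
    have e : (Fin.snoc (Fin.consEquiv (fun _ => Fin D) (q, p) : Fin (n + 1) → Fin D) j :
        Fin (n + 2) → Fin D) = Fin.cons q (Fin.snoc p j : Fin (n + 1) → Fin D) :=
      (Fin.cons_snoc_eq_snoc_cons (β := Fin D) q p j).symm
    rw [e]
    rfl

/-- The amplitude of a translation-invariant matrix product state as a sum over closed paths of
bond indices. -/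
theorem applyLocal_cycleState {D d L : ℕ} (A : Matrix (Fin d) (Fin D × Fin D) ℂ)
    (s : Fin L → Fin d) :
    applyLocal A (cycleState D L) s =
      ∑ p : Fin L → Fin D, ∏ i, A (s i) (p i, p (finRotate L i)) := by
  rw [applyLocal]
  symm
  refine Fintype.sum_of_injective (fun p i => (p i, p (finRotate L i))) ?_ _ _ ?_ ?_
  · intro p q h
    funext i
    exact congrArg Prod.fst (congrFun h i)
  · intro x hx
    have : cycleState D L x = 0 := by
      rw [cycleState, Finset.prod_boole, if_neg]
      intro h
      exact hx ⟨fun i => (x i).1, funext fun i => Prod.ext rfl (h i (Finset.mem_univ i)).symm⟩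
    rw [this, mul_zero]
  · intro p
    simp [cycleState]

/-- The amplitude of a translation-invariant matrix product state as the trace of a product of
matrices. -/
theorem applyLocal_cycleState_eq_trace {D d n : ℕ} (A : Matrix (Fin d) (Fin D × Fin D) ℂ)
    (s : Fin (n + 1) → Fin d) :
    applyLocal A (cycleState D (n + 1)) s =
      (List.ofFn fun i => Matrix.of fun j k => A (s i) (j, k)).prod.trace := by
  rw [applyLocal_cycleState, ← (Fin.consEquiv fun _ => Fin D).sum_comp, Fintype.sum_prod_type,
    Matrix.trace]
  refine Finset.sum_congr rfl fun i _ => ?_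
  rw [Matrix.diag_apply, list_prod_ofFn_apply]
  refine Finset.sum_congr rfl fun p _ => Finset.prod_congr rfl fun k _ => ?_
  rw [Fin.snoc_eq_cons_rotate]
  rfl

/-- If each local basis state `s` is produced from a single bond configuration `ξ s`, the sum
defining the amplitude has a single term. -/
theorem applyLocal_of_single {ι κ : Type} [Fintype ι] [DecidableEq ι] {L : ℕ} (A : Matrix κ ι ℂ)
    (ξ : κ → ι) (w : κ → ℂ) (hA : ∀ s x, A s x = if x = ξ s then w s else 0) (φ : State ι L)
    (s : Fin L → κ) : applyLocal A φ s = (∏ i, w (s i)) * φ fun i => ξ (s i) := by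
  rw [applyLocal, Finset.sum_eq_single fun i => ξ (s i)]
  · simp [hA]
  · intro x _ hx
    obtain ⟨i, hi⟩ := Function.ne_iff.1 hx
    rw [Finset.prod_eq_zero (Finset.mem_univ i) (by rw [hA, if_neg hi]), zero_mul]
  · simp

/-! ### Amplitudes of `psi` -/

theorem psi_apply (n : ℕ) (s : Fin (n + 1) → Fin 3) :
    psi (n + 1) s = ((Real.sqrt (n + 1 : ℕ) : ℝ) : ℂ)⁻¹ *
      ∑ k : Fin (n + 1), if (fun j => s (j + k)) = word (n + 1) then 1 else 0 := by
  have hshift : ∀ (i : ℕ) (φ : State (Fin 3) (n + 1)) (t : Fin (n + 1) → Fin 3),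
      ((shift (Fin 3) (n + 1))^[i]) φ t = φ fun j => t (j + Fin.ofNat (n + 1) i) := by
    intro i
    induction i with
    | zero => intro φ t; simp
    | succ i ih =>
      intro φ t
      rw [Function.iterate_succ_apply, ih]
      simp only [shift, LinearMap.funLeft_apply, Function.comp_def, finRotate_apply]
      congr 1
      funext j
      congr 1
      ext
      simp [Fin.val_add, add_assoc, add_comm 1 i]
  rw [psi, Pi.smul_apply, smul_eq_mul, Finset.sum_apply]
  congr 1
  rw [← Fin.sum_univ_eq_sum_range
    (fun i => ((shift (Fin 3) (n + 1))^[i]) (Pi.single (word (n + 1)) 1) s)]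
  refine Finset.sum_congr rfl fun k _ => ?_
  rw [hshift]
  simp [Pi.single_apply]

theorem word_zero (n : ℕ) : word (n + 1) 0 = 2 := by simp [word]

theorem word_eq_two_iff {n : ℕ} {j : Fin (n + 1)} : word (n + 1) j = 2 ↔ j = 0 := by
  rw [word]
  split_ifs with h h'
  · simpa using Fin.ext h
  · simp; rintro rfl; exact h rfl
  · simp; rintro rfl; exact h rfl

/-- The amplitudes of `psi` vanish on every configuration with two letters `2`. -/
theorem psi_eq_zero_of_two {n : ℕ} {s : Fin (n + 1) → Fin 3} {i j : Fin (n + 1)} (hij : i ≠ j)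
    (hi : s i = 2) (hj : s j = 2) : psi (n + 1) s = 0 := by
  rw [psi_apply, Finset.sum_eq_zero, mul_zero]
  intro k _
  rw [if_neg]
  intro h
  have h1 : ∀ i, s i = 2 → i = k := by
    intro i hi
    have := congrFun h (i - k)
    simp only [sub_add_cancel, hi] at this
    exact sub_eq_zero.1 (word_eq_two_iff.1 this.symm)
  exact hij ((h1 i hi).trans (h1 j hj).symm)

/-- A configuration with a `2` at site `k` has non-zero amplitude exactly if it is the word
rotated by `k`. -/
theorem psi_of_eq_two {n : ℕ} {s : Fin (n + 1) → Fin 3} {k : Fin (n + 1)} (hk : s k = 2) :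
    psi (n + 1) s = if (fun j => s (j + k)) = word (n + 1)
      then ((Real.sqrt (n + 1 : ℕ) : ℝ) : ℂ)⁻¹ else 0 := by
  rw [psi_apply, Finset.sum_eq_single k]
  · simp
  · intro i _ hi
    rw [if_neg]
    intro h
    have := congrFun h (k - i)
    simp only [sub_add_cancel, hk] at this
    exact hi (sub_eq_zero.1 (word_eq_two_iff.1 this.symm)).symm
  · simp

theorem psi_eq_zero_of_ne_two {n : ℕ} {s : Fin (n + 1) → Fin 3} (hs : ∀ i, s i ≠ 2) :
    psi (n + 1) s = 0 := by
  rw [psi_apply, Finset.sum_eq_zero, mul_zero]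
  intro k _
  rw [if_neg]
  intro h
  have := congrFun h 0
  rw [word_zero] at this
  exact hs _ this

theorem sqrt_inv_ne_zero (n : ℕ) : ((Real.sqrt (n + 1 : ℕ) : ℝ) : ℂ)⁻¹ ≠ 0 := by
  refine inv_ne_zero (Complex.ofReal_ne_zero.2 ?_)
  positivity

/-! ### The two-state automaton -/

/-- The bond states `(σ, τ)` before and after each letter in the automaton with states `0, 1`
whose closed paths with one letter `2` spell the rotations of `2 1 0 1 0 ⋯ 1 0`. -/
def bondPair (s : Fin 3) : Fin 2 × Fin 2 :=
  if s = 0 then (1, 0) else if s = 1 then (0, 1) else (0, 0)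

theorem cycleState_bondPair {n : ℕ} (s : Fin (n + 1) → Fin 3) :
    cycleState 2 (n + 1) (fun i => bondPair (s i)) =
      if ∀ i, (bondPair (s i)).2 = (bondPair (s (i + 1))).1 then 1 else 0 := by
  simp [cycleState, Finset.prod_boole]

/-- With exactly one letter `2`, at site `k`, a configuration is a closed path of the automaton if
and only if it is a rotation of the word. -/
theorem bondPair_closed_iff {n : ℕ} (hn : Odd (n + 1)) (h3 : 3 ≤ n + 1)
    {s : Fin (n + 1) → Fin 3} {k : Fin (n + 1)} (hk : s k = 2) (huniq : ∀ i, s i = 2 → i = k) :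
    (∀ i, (bondPair (s i)).2 = (bondPair (s (i + 1))).1) ↔
      (fun j => s (j + k)) = word (n + 1) := by
  constructor
  · intro h
    have hfin0 : ∀ c : Fin 3, c ≠ 2 → (bondPair 0).2 = (bondPair c).1 → c = 1 := by decide
    have hfin1 : ∀ c : Fin 3, (bondPair 1).2 = (bondPair c).1 → c = 0 := by decide
    have hfin2 : ∀ c : Fin 3, c ≠ 2 → (bondPair 2).2 = (bondPair c).1 → c = 1 := by decide
    have key : ∀ m (hm : m < n + 1), s (⟨m, hm⟩ + k) = word (n + 1) ⟨m, hm⟩ := by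
      intro m
      induction m with
      | zero =>
        intro hm
        have : (⟨0, hm⟩ : Fin (n + 1)) = 0 := rfl
        rw [this, zero_add, hk, word_zero]
      | succ m ih =>
        intro hm
        have h1 := h (⟨m, by omega⟩ + k)
        have e : (⟨m, by omega⟩ + k + 1 : Fin (n + 1)) = ⟨m + 1, hm⟩ + k := by
          rw [add_right_comm]
          congr 1
          ext
          simp [Fin.val_add, Nat.mod_eq_of_lt hm]
        rw [e, ih (by omega)] at h1
        have h2 : s (⟨m + 1, hm⟩ + k) ≠ 2 := by
          intro h2
          have := huniq _ h2
          simp at this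
        generalize s (⟨m + 1, hm⟩ + k) = c at h1 h2
        simp only [word] at h1 ⊢
        rcases Nat.eq_zero_or_pos m with rfl | hm0
        · simp only [if_true] at h1
          simpa using hfin2 c h2 h1
        · rcases Nat.mod_two_eq_zero_or_one m with h | h
          · have h' : (m + 1) % 2 = 1 := by omega
            simp only [hm0.ne', h, if_false, zero_ne_one] at h1
            simpa [h'] using hfin0 c h2 h1
          · have h' : (m + 1) % 2 = 0 := by omega
            simp only [hm0.ne', h, if_false, if_true] at h1
            simpa [h'] using hfin1 c h1
    funext j
    exact key j j.2
  · intro h i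
    have hs : ∀ i, s i = word (n + 1) (i - k) := fun i => by rw [← h]; simp
    have e : i + 1 - k = (i - k) + 1 := by abel
    rw [hs, hs, e]
    generalize i - k = j
    have hn2 : n % 2 = 0 := by obtain ⟨r, hr⟩ := hn; omega
    rcases eq_or_ne j (Fin.last n) with rfl | hj
    · have h0 : n ≠ 0 := by omega
      simp [word, h0, hn2, bondPair]
    · have hv : ((j + 1 : Fin (n + 1)) : ℕ) = j + 1 := by
        rw [Fin.val_add_one, if_neg hj]
      simp only [word, hv]
      rcases Nat.eq_zero_or_pos (j : ℕ) with h0 | h0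
      · simp [h0, bondPair]
      · rcases Nat.mod_two_eq_zero_or_one (j : ℕ) with h' | h'
        · have h'' : ((j : ℕ) + 1) % 2 = 1 := by omega
          simp [h0.ne', h', h'', bondPair]
        · have h'' : ((j : ℕ) + 1) % 2 = 0 := by omega
          simp [h0.ne', h', h'', bondPair]

/-- Closed paths of odd length contain a letter `2`. -/
theorem exists_two_of_bondPair_closed {n : ℕ} (hn : Odd (n + 1))
    {s : Fin (n + 1) → Fin 3} (h : ∀ i, (bondPair (s i)).2 = (bondPair (s (i + 1))).1) :
    ∃ k, s k = 2 := by
  by_contra! hne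
  have key : ∀ m : ℕ, bondPair (s (Fin.ofNat (n + 1) m)) =
      if Even m then bondPair (s 0) else (bondPair (s 0)).swap := by
    intro m
    induction m with
    | zero => simp
    | succ m ih =>
      have h1 := h (Fin.ofNat (n + 1) m)
      have e : (Fin.ofNat (n + 1) m + 1 : Fin (n + 1)) = Fin.ofNat (n + 1) (m + 1) := by
        ext; simp [Fin.val_add]
      rw [e] at h1
      have hstep : ∀ c d : Fin 3, c ≠ 2 → d ≠ 2 → (bondPair c).2 = (bondPair d).1 →
          bondPair d = (bondPair c).swap := by decide
      rw [hstep _ _ (hne _) (hne _) h1, ih]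
      by_cases hm : Even m <;> simp [hm, Nat.even_add_one]
  have h1 := key (n + 1)
  rw [if_neg (Nat.not_even_iff_odd.2 hn)] at h1
  have hswap : ∀ c : Fin 3, c ≠ 2 → bondPair c ≠ (bondPair c).swap := by decide
  refine hswap _ (hne 0) ?_
  rw [← h1]
  congr 2
  ext; simp

theorem psi_eq_zero_of_not_closed {n : ℕ} (hn : Odd (n + 1)) (h3 : 3 ≤ n + 1)
    {s : Fin (n + 1) → Fin 3} (h : ¬ ∀ i, (bondPair (s i)).2 = (bondPair (s (i + 1))).1) :
    psi (n + 1) s = 0 := by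
  by_cases hs : ∃ k, s k = 2
  · obtain ⟨k, hk⟩ := hs
    by_cases hu : ∀ i, s i = 2 → i = k
    · rw [psi_of_eq_two hk, if_neg]
      rwa [← bondPair_closed_iff hn h3 hk hu]
    · push Not at hu
      obtain ⟨i, hi, hik⟩ := hu
      exact psi_eq_zero_of_two hik hi hk
  · push Not at hs
    exact psi_eq_zero_of_ne_two hs

/-- `psi` has the value of the closed-path indicator on configurations with one letter `2`. -/
theorem psi_of_closed {n : ℕ} (hn : Odd (n + 1)) (h3 : 3 ≤ n + 1)
    {s : Fin (n + 1) → Fin 3} (h : ∀ i, (bondPair (s i)).2 = (bondPair (s (i + 1))).1)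
    {k : Fin (n + 1)} (hk : s k = 2) (hu : ∀ i, s i = 2 → i = k) :
    psi (n + 1) s = ((Real.sqrt (n + 1 : ℕ) : ℝ) : ℂ)⁻¹ := by
  rw [psi_of_eq_two hk, if_pos ((bondPair_closed_iff hn h3 hk hu).1 h)]

/-! ### Bond dimension two with border and weight states -/

/-- The weight of a letter: `c` for the letter `2`, and `1` for the others. -/
def letterWeight {R : Type*} [One R] (c : R) (s : Fin 3) : R := if s = 2 then c else 1

theorem prod_letterWeight_of_unique {R : Type*} [CommMonoid R] {n : ℕ} (c : R)
    {s : Fin (n + 1) → Fin 3} {k : Fin (n + 1)} (hk : s k = 2) (hu : ∀ i, s i = 2 → i = k) :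
    ∏ i, letterWeight c (s i) = c := by
  rw [Finset.prod_eq_single k]
  · simp [letterWeight, hk]
  · intro i _ hi
    rw [letterWeight, if_neg fun h => hi (hu i h)]
  · simp

/-- The border representation of degree one: the automaton, with the letter `2` weighted by
`ε / √L`. -/
noncomputable def borderMap (L : ℕ) : Matrix (Fin 3) (Fin 2 × Fin 2) ℂ[X] :=
  fun s x => if x = bondPair s
    then letterWeight (C ((Real.sqrt L : ℝ) : ℂ)⁻¹ * X) s else 0

theorem natDegree_borderMap_le (L : ℕ) (s : Fin 3) (x : Fin 2 × Fin 2) :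
    (borderMap L s x).natDegree ≤ 1 := by
  rw [borderMap, letterWeight]
  split_ifs
  · exact (natDegree_C_mul_le _ _).trans natDegree_X_le
  · simp
  · simp

theorem isBorderRep_borderMap {n : ℕ} (hn : Odd (n + 1)) (h3 : 3 ≤ n + 1) :
    IsBorderRep (borderMap (n + 1)) 1 (psi (n + 1)) := by
  rw [IsBorderRep, tendsto_pi_nhds]
  intro s
  set t : ℂ := ((Real.sqrt (n + 1 : ℕ) : ℝ) : ℂ)⁻¹ with ht
  have hval : ∀ ε : ℂ, ((ε ^ 1)⁻¹ • applyLocal ((borderMap (n + 1)).map fun p => p.eval ε)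
      (cycleState 2 (n + 1))) s = ε⁻¹ * ((∏ i, letterWeight (t * ε) (s i)) *
        if ∀ i, (bondPair (s i)).2 = (bondPair (s (i + 1))).1 then 1 else 0) := by
    intro ε
    rw [Pi.smul_apply, pow_one, smul_eq_mul,
      applyLocal_of_single _ bondPair (letterWeight (t * ε)), cycleState_bondPair]
    intro c x
    rw [Matrix.map_apply, borderMap, letterWeight, letterWeight]
    split_ifs <;> simp [ht]
  simp only [hval]
  by_cases h : ∀ i, (bondPair (s i)).2 = (bondPair (s (i + 1))).1
  swap
  · simp only [h, if_false, mul_zero, psi_eq_zero_of_not_closed hn h3 h]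
    exact tendsto_const_nhds
  simp only [h, if_true, mul_one, implies_true]
  obtain ⟨k, hk⟩ := exists_two_of_bondPair_closed hn h
  by_cases hu : ∀ i, s i = 2 → i = k
  · rw [psi_of_closed hn h3 h hk hu]
    simp only [prod_letterWeight_of_unique _ hk hu]
    refine tendsto_const_nhds.congr' ?_
    filter_upwards [self_mem_nhdsWithin] with ε hε
    have : ε ≠ 0 := hε
    rw [← ht, mul_comm t, inv_mul_cancel_left₀ this]
  -- with at least two letters `2` the amplitude is divisible by `ε ^ 2`
  · push Not at hu
    obtain ⟨j, hj, hjk⟩ := hu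
    rw [psi_eq_zero_of_two hjk hj hk]
    have hcont : Continuous fun ε : ℂ => t * (t * ε) *
        ∏ i ∈ (Finset.univ.erase k).erase j, letterWeight (t * ε) (s i) := by
      refine Continuous.mul (by fun_prop) (continuous_finsetProd _ fun i _ => ?_)
      by_cases hi : s i = 2
      · simp only [letterWeight, hi, if_true]; fun_prop
      · simp only [letterWeight, hi, if_false]; fun_prop
    have hlim := (hcont.tendsto 0).mono_left (nhdsWithin_le_nhds (s := {0}ᶜ))
    simp only [mul_zero, zero_mul] at hlim
    refine hlim.congr' ?_
    filter_upwards [self_mem_nhdsWithin] with ε hε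
    have hε0 : ε ≠ 0 := hε
    rw [← Finset.mul_prod_erase _ _ (Finset.mem_univ k),
      ← Finset.mul_prod_erase _ _ (Finset.mem_erase.2 ⟨hjk, Finset.mem_univ j⟩)]
    have hk' : letterWeight (t * ε) (s k) = t * ε := by simp [letterWeight, hk]
    have hj' : letterWeight (t * ε) (s j) = t * ε := by simp [letterWeight, hj]
    rw [hk', hj']
    field_simp

theorem psi_mem_bTNS {n : ℕ} (hn : Odd (n + 1)) (h3 : 3 ≤ n + 1) :
    psi (n + 1) ∈ bTNS (n + 1) 2 1 1 3 := by
  set t : ℂ := ((Real.sqrt (n + 1 : ℕ) : ℝ) : ℂ)⁻¹ with ht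
  refine ⟨fun s x => if x = (bondPair s, if s = 2 then 1 else 0) then letterWeight t s else 0, ?_⟩
  funext s
  rw [applyLocal_of_single _ (fun s => (bondPair s, if s = 2 then 1 else 0)) (letterWeight t)
    fun _ _ => rfl]
  simp only [tensor]
  rw [cycleState_bondPair, weightState]
  by_cases h : ∀ i, (bondPair (s i)).2 = (bondPair (s (i + 1))).1
  swap
  · simp only [h, if_false, zero_mul, mul_zero, psi_eq_zero_of_not_closed hn h3 h]
  obtain ⟨k, hk⟩ := exists_two_of_bondPair_closed hn h
  have hcount : ∑ i, (((if s i = 2 then 1 else 0 : Fin 2)) : ℕ)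
      = (Finset.univ.filter fun i => s i = 2).card := by
    rw [Finset.card_filter]
    exact Finset.sum_congr rfl fun i _ => by split_ifs <;> rfl
  rw [if_pos h, hcount]
  by_cases hu : ∀ i, s i = 2 → i = k
  · rw [psi_of_closed hn h3 h hk hu, prod_letterWeight_of_unique t hk hu, if_pos]
    · simp [ht]
    · rw [Finset.card_eq_one]
      exact ⟨k, by ext i; simp; exact ⟨hu i, fun h => h ▸ hk⟩⟩
  · push Not at hu
    obtain ⟨j, hj, hjk⟩ := hu
    rw [psi_eq_zero_of_two hjk hj hk, if_neg]
    · simp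
    · have : 1 < (Finset.univ.filter fun i => s i = 2).card :=
        Finset.one_lt_card.2 ⟨j, by simp [hj], k, by simp [hk], hjk⟩
      omega

/-! ### Border bond dimension at least two -/

/-- With at most one bond configuration the amplitudes are invariant under permutations of
the sites. -/
theorem applyLocal_comp_perm {ι κ : Type} [Fintype ι] [Subsingleton ι] {L : ℕ}
    (A : Matrix κ ι ℂ) (φ : State ι L) (s : Fin L → κ) (π : Equiv.Perm (Fin L)) :
    applyLocal A φ (s ∘ π) = applyLocal A φ s := by
  refine Finset.sum_congr rfl fun x _ => ?_
  congr 1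
  rw [← Equiv.prod_comp π fun i => A (s i) (x i)]
  exact Finset.prod_congr rfl fun i _ => by rw [Subsingleton.elim (x i) (x (π i))]; rfl

theorem two_le_of_isBorderRep {n D a : ℕ} (h3 : 3 ≤ n + 1)
    {A : Matrix (Fin 3) (Fin D × Fin D) ℂ[X]} (hA : IsBorderRep A a (psi (n + 1))) : 2 ≤ D := by
  by_contra! hD
  have : Subsingleton (Fin D) := by
    rw [← Fintype.card_le_one_iff_subsingleton, Fintype.card_fin]; omega
  -- exchanging the letters at sites `1` and `2` of `2 1 0 ⋯` gives no rotation of the word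
  set i1 : Fin (n + 1) := ⟨1, by omega⟩ with hi1
  set i2 : Fin (n + 1) := ⟨2, by omega⟩ with hi2
  set π : Equiv.Perm (Fin (n + 1)) := Equiv.swap i1 i2
  rw [IsBorderRep, tendsto_pi_nhds] at hA
  have h1 := hA (word (n + 1))
  have h2 := hA (word (n + 1) ∘ π)
  simp only [Pi.smul_apply, applyLocal_comp_perm] at h1 h2
  have heq := tendsto_nhds_unique h1 h2
  have h0 : word (n + 1) 0 = 2 := word_zero n
  have h0' : (word (n + 1) ∘ π) 0 = 2 := by
    have : π 0 = 0 := Equiv.swap_apply_of_ne_of_ne (by simp [hi1, Fin.ext_iff])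
      (by simp [hi2, Fin.ext_iff])
    simp [this, h0]
  rw [psi_of_eq_two h0, psi_of_eq_two h0', if_pos (by simp), if_neg] at heq
  · exact sqrt_inv_ne_zero n heq
  · intro h
    have := congrFun h i1
    simp [π, word, hi1, hi2] at this

theorem borderBond_psi {n : ℕ} (hn : Odd (n + 1)) (h3 : 3 ≤ n + 1) :
    borderBond (psi (n + 1)) = 2 := by
  refine le_antisymm (Nat.sInf_le ⟨1, _, isBorderRep_borderMap hn h3⟩) ?_
  obtain ⟨a, A, hA⟩ := Nat.sInf_mem (s := {D | ∃ (a : ℕ)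
    (A : Matrix (Fin 3) (Fin D × Fin D) ℂ[X]), IsBorderRep A a (psi (n + 1))})
    ⟨2, 1, _, isBorderRep_borderMap hn h3⟩
  exact two_le_of_isBorderRep h3 hA

/-! ### Exact representations -/

/-- A representation of bond dimension `L`: the bond index is the position in the word. -/
theorem psi_mem_TNS_self (n : ℕ) : psi (n + 1) ∈ TNS (n + 1) (n + 1) 3 := by
  obtain ⟨c, hc⟩ := IsAlgClosed.exists_pow_nat_eq
    (((Real.sqrt (n + 1 : ℕ) : ℝ) : ℂ)⁻¹) (Nat.succ_pos n)
  refine ⟨Matrix.of fun s x => if word (n + 1) x.1 = s ∧ x.2 = x.1 + 1 then c else 0, ?_⟩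
  funext s
  rw [applyLocal_cycleState, psi_apply, ← hc, Finset.mul_sum]
  simp only [Matrix.of_apply]
  refine Fintype.sum_of_injective (fun (k : Fin (n + 1)) i => i - k) ?_ _ _ ?_ ?_
  · intro k l h
    simpa using congrFun h 0
  · intro p hp
    by_contra hne
    refine hp ⟨-p 0, funext fun i => ?_⟩
    have hstep : ∀ i, p (i + 1) = p i + 1 := by
      intro i
      by_contra hi
      refine hne (Finset.prod_eq_zero (Finset.mem_univ i) (if_neg fun h => hi ?_))
      simpa using h.2
    have key : ∀ m : ℕ, p (Fin.ofNat (n + 1) m) = Fin.ofNat (n + 1) m + p 0 := by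
      intro m
      induction m with
      | zero => simp
      | succ m ih =>
        have e : (Fin.ofNat (n + 1) (m + 1) : Fin (n + 1)) = Fin.ofNat (n + 1) m + 1 := by
          ext; simp [Fin.val_add]
        rw [e, hstep, ih]; abel
    simpa using (key i).symm
  · intro k
    by_cases h : (fun j => s (j + k)) = word (n + 1)
    · have h' : ∀ i, word (n + 1) (i - k) = s i := fun i => by rw [← h]; simp
      rw [if_pos h, mul_one]
      simp only [h', finRotate_apply, true_and]
      rw [Finset.prod_congr rfl fun i _ => if_pos (by abel)]
      simp
    · rw [if_neg h, mul_zero]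
      have : ∃ i, word (n + 1) (i - k) ≠ s i := by
        by_contra! h'
        exact h (funext fun j => by rw [← h']; simp)
      obtain ⟨i, hi⟩ := this
      exact (Finset.prod_eq_zero (Finset.mem_univ i) (if_neg fun h => hi h.1)).symm

theorem exists_ofFn_eq {α : Type*} {m : ℕ} {w : List α} (h : w.length = m) :
    ∃ s : Fin m → α, List.ofFn s = w := by
  subst h
  exact ⟨w.get, List.ofFn_get w⟩

/-- In a representation of `psi`, only the word `2 1 0 ⋯ 1 0` contributes to
`tr (A 2 * (A 0 + A 1) ^ (L - 1))`. The statement fixes the first letters `2 :: u` and expands the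
remaining factors one at a time. -/
theorem trace_prefix_mul_pow {D n : ℕ} {A : Fin 3 → Matrix (Fin D) (Fin D) ℂ}
    (hA : ∀ s : Fin (n + 1) → Fin 3, psi (n + 1) s = (List.ofFn fun i => A (s i)).prod.trace)
    (m : ℕ) : ∀ u : List (Fin 3), u.length + 1 + m = n + 1 →
      ((((2 :: u).map A).prod) * (A 0 + A 1) ^ m).trace =
        if 2 :: u <+: List.ofFn (word (n + 1))
          then ((Real.sqrt (n + 1 : ℕ) : ℝ) : ℂ)⁻¹ else 0 := by
  induction m with
  | zero =>
    intro u hu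
    obtain ⟨s, hs⟩ := exists_ofFn_eq (w := 2 :: u) (m := n + 1) (by simpa using hu)
    have hs0 : s 0 = 2 := by
      rw [List.ofFn_succ] at hs
      exact (List.cons.inj hs).1
    have hiff : 2 :: u <+: List.ofFn (word (n + 1)) ↔ (fun j => s (j + 0)) = word (n + 1) := by
      simp only [add_zero]
      rw [← hs]
      constructor
      · intro h
        exact List.ofFn_injective (h.eq_of_length (by simp))
      · intro h
        rw [← h]
    rw [pow_zero, mul_one, if_congr hiff rfl rfl, ← psi_of_eq_two hs0, hA, ← hs, List.map_ofFn]
    rfl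
  | succ m ih =>
    intro u hu
    have h0 := ih (u ++ [0]) (by simp; omega)
    have h1 := ih (u ++ [1]) (by simp; omega)
    rw [← List.cons_append] at h0 h1
    have e : (((2 :: u).map A).prod) * (A 0 + A 1) ^ (m + 1)
        = (((2 :: u) ++ [0]).map A).prod * (A 0 + A 1) ^ m
          + (((2 :: u) ++ [1]).map A).prod * (A 0 + A 1) ^ m := by
      rw [pow_succ', List.map_append, List.map_append, List.prod_append, List.prod_append]
      simp only [List.map_cons, List.map_nil, List.prod_singleton, mul_add, add_mul, mul_assoc]
    rw [e, Matrix.trace_add, h0, h1]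
    by_cases hpre : 2 :: u <+: List.ofFn (word (n + 1))
    · obtain ⟨t, ht⟩ := hpre
      have hlen := congrArg List.length ht
      rcases t with _ | ⟨d, t⟩
      · simp at hlen; omega
      have hd : d ≠ 2 := by
        intro hd
        have hi : u.length + 1 < n + 1 := by omega
        have h2 : (List.ofFn (word (n + 1)))[u.length + 1]'(by simpa using hi) = d := by
          rw [List.getElem_of_eq ht.symm]; simp
        rw [List.getElem_ofFn, hd, word_eq_two_iff] at h2
        simp at h2
      have hcases : d = 0 ∨ d = 1 :=
        (by decide : ∀ c : Fin 3, c ≠ 2 → c = 0 ∨ c = 1) d hd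
      rw [← ht, if_pos (List.prefix_append _ _)]
      simp only [List.prefix_append_right_inj, List.cons_prefix_cons, List.nil_prefix, and_true]
      rcases hcases with rfl | rfl <;> simp
    · rw [if_neg hpre, if_neg fun h => hpre ((List.prefix_append _ _).trans h),
        if_neg fun h => hpre ((List.prefix_append _ _).trans h), add_zero]

/-- A representation of `psi` on `L` sites of bond dimension `D` forces `L = O(D ^ 3)`. -/
theorem lt_of_psi_mem_TNS {n D : ℕ} (h : psi (n + 1) ∈ TNS (n + 1) D 3) :
    n + 1 < 3 * D ^ 2 * (2 * D + 1) + D := by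
  obtain ⟨B, hB⟩ := h
  set A : Fin 3 → Matrix (Fin D) (Fin D) ℂ := fun s => Matrix.of fun j k => B s (j, k) with hAdef
  have hA : ∀ s : Fin (n + 1) → Fin 3,
      psi (n + 1) s = (List.ofFn fun i => A (s i)).prod.trace := by
    intro s
    rw [hB, applyLocal_cycleState_eq_trace]
  by_contra! hL
  have htr : ∀ x ∈ wordSpan A (n + 1) 2, x.trace = 0 := by
    intro x hx
    induction hx using Submodule.span_induction with
    | mem x hx =>
      obtain ⟨w, hw, h2, rfl⟩ := hx
      obtain ⟨s, rfl⟩ := exists_ofFn_eq hw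
      obtain ⟨i, j, hij, hi, hj⟩ := List.duplicate_iff_exists_distinct_get.1
        (List.duplicate_iff_two_le_count.2 h2)
      rw [List.map_ofFn]
      refine (hA s).symm.trans (psi_eq_zero_of_two (i := i.cast (by simp)) (j := j.cast (by simp))
        ?_ ?_ ?_)
      · exact fun h => hij.ne (by simpa [Fin.ext_iff] using h)
      · exact (hi.trans (List.get_ofFn s i)).symm
      · exact (hj.trans (List.get_ofFn s j)).symm
    | zero => simp
    | add x y _ _ hx hy => rw [Matrix.trace_add, hx, hy, add_zero]
    | smul c x _ hx => rw [Matrix.trace_smul, hx, smul_zero]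
  have hzero := trace_letter_two_mul_pow_eq_zero A hL htr (A 0 + A 1)
    (Submodule.add_mem _ (letter_mem_wordSpan 0) (letter_mem_wordSpan 1))
  have hval := trace_prefix_mul_pow hA n [] (by simp; omega)
  rw [if_pos (by rw [List.ofFn_succ, word_zero]; simp)] at hval
  simp only [List.map_cons, List.map_nil, List.prod_singleton] at hval
  rw [Nat.add_sub_cancel, hval] at hzero
  exact sqrt_inv_ne_zero n hzero

theorem rpow_div_log_le_of_psi_mem_TNS {L D : ℕ} (hL : 3 ≤ L) (h : psi L ∈ TNS L D 3) :
    (1 / 3 : ℝ) * ((L : ℝ) ^ (1 / 3 : ℝ) / Real.log L) ≤ D := by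
  obtain ⟨n, rfl⟩ : ∃ n, L = n + 1 := ⟨L - 1, by omega⟩
  have hlt := lt_of_psi_mem_TNS h
  have hD : 1 ≤ D := by
    rcases Nat.eq_zero_or_pos D with rfl | h
    · simp at hlt
    · exact h
  have hle : n + 1 ≤ (3 * D) ^ 3 := by nlinarith [Nat.pow_le_pow_left hD 2, Nat.zero_le (D ^ 3)]
  have hle' : ((n + 1 : ℕ) : ℝ) ≤ ((3 * D : ℕ) : ℝ) ^ (3 : ℕ) := by exact_mod_cast hle
  have hroot : ((n + 1 : ℕ) : ℝ) ^ (1 / 3 : ℝ) ≤ 3 * D := by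
    refine (Real.rpow_le_rpow (by positivity) hle' (by norm_num)).trans_eq ?_
    rw [← Real.rpow_natCast, ← Real.rpow_mul (by positivity)]
    norm_num
  have hlog : 1 ≤ Real.log (n + 1 : ℕ) := by
    rw [Real.le_log_iff_exp_le (by positivity)]
    have : (3 : ℝ) ≤ (n + 1 : ℕ) := by exact_mod_cast hL
    linarith [Real.exp_one_lt_d9]
  have hdiv := div_le_self (Real.rpow_nonneg (Nat.cast_nonneg (n + 1)) (1 / 3 : ℝ)) hlog
  linarith

theorem bond_psi_mem {L : ℕ} (hL : 3 ≤ L) : psi L ∈ TNS L (bond (psi L)) 3 := by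
  obtain ⟨n, rfl⟩ : ∃ n, L = n + 1 := ⟨L - 1, by omega⟩
  exact Nat.sInf_mem (s := {D | psi (n + 1) ∈ TNS (n + 1) D 3}) ⟨n + 1, psi_mem_TNS_self n⟩

end TIMPS

theorem mainTheorem3 :
    (∀ L : ℕ, Odd L → 3 ≤ L →
      TIMPS.borderBond (TIMPS.psi L) = 2 ∧
      (∃ A : Matrix (Fin 3) (Fin 2 × Fin 2) ℂ[X],
        (∀ s x, (A s x).natDegree ≤ 1) ∧ TIMPS.IsBorderRep A 1 (TIMPS.psi L)) ∧
      TIMPS.psi L ∈ TIMPS.bTNS L 2 1 1 3) ∧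
    (∃ c : ℝ, 0 < c ∧ ∃ L₀ : ℕ, ∀ L : ℕ, Odd L → L₀ ≤ L →
      c * ((L : ℝ) ^ (1 / 3 : ℝ) / Real.log L) ≤ (TIMPS.bond (TIMPS.psi L) : ℝ)) ∧
    (∀ D : ℕ, ∃ L₀ : ℕ, ∀ L : ℕ, Odd L → L₀ ≤ L → TIMPS.psi L ∉ TIMPS.TNS L D 3) := by
  refine ⟨fun L hodd hL => ?_, ⟨1 / 3, by norm_num, 3, fun L _ hL => ?_⟩, fun D => ?_⟩
  · obtain ⟨n, rfl⟩ : ∃ n, L = n + 1 := ⟨L - 1, by omega⟩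
    exact ⟨TIMPS.borderBond_psi hodd hL, ⟨TIMPS.borderMap (n + 1),
      TIMPS.natDegree_borderMap_le (n + 1), TIMPS.isBorderRep_borderMap hodd hL⟩,
      TIMPS.psi_mem_bTNS hodd hL⟩
  · exact TIMPS.rpow_div_log_le_of_psi_mem_TNS hL (TIMPS.bond_psi_mem hL)
  · refine ⟨3 * D ^ 2 * (2 * D + 1) + D + 1, fun L _ hL h => ?_⟩
    obtain ⟨n, rfl⟩ : ∃ n, L = n + 1 := ⟨L - 1, by omega⟩
    have := TIMPS.lt_of_psi_mem_TNS h
    omega
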